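/- Let $\mathcal X,\mathcal Y$ be finite sets and let $(n_x)_{x\in\mathcal X}$, $(m_y)_{y\in\mathcal Y}$ be positive real numbers. For each $x$ let $\mathbf P_x$ be a probability distribution of a random vector $((\varepsilon_y)_{y\in\mathcal Y},\varepsilon_0)\in\mathbb R^{\mathcal Y\cup\{0\}}$, and for each $y$ let $\mathbf Q_y$ be a probability distribution of a random vector $((\eta_x)_{x\in\mathcal X},\eta_0)\in\mathbb R^{\mathcal X\cup\{0\}}$, all of whose coordinates have finite expectation. Write $\underline{\mathbb R}=\mathbb R\cup\{-\infty\}$, with $0\cdot(-\infty)=0$ and with its order topology, and for $U,V\in\underline{\mathbb R}^{\mathcal X\times\mathcal Y}$ put $$G(U)=\sum_{x\in\mathcal X} n_x\,\mathbb E_{\mathbf P_x}\Big[\max_{y\in\mathcal Y}\{U_{xy}+\varepsilon_y,\varepsilon_0\}\Big],\qquad H(V)=\sum_{y\in\mathcal Y} m_y\,\mathbb E_{\mathbf Q_y}\Big[\max_{x\in\mathcal X}\{V_{xy}+\eta_x,\eta_0\}\Big].$$ For $F:\underline{\mathbb R}^{\mathcal X\times\mathcal Y}\to\mathbb R$ let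 $F^*(\mu)=\sup_{U\in\mathbb R^{\mathcal X\times\mathcal Y}}\{\sum_{xy}\mu_{xy}U_{xy}-F(U)\}\in(-\infty,+\infty]$ for $\mu\in\mathbb R^{\mathcal X\times\mathcal Y}$, let $\operatorname{dom}F^*=\{\mu: F^*(\mu)<\infty\}$, and let $\partial F(U)=\{\mu\in\mathbb R^{\mathcal X\times\mathcal Y}: F^*(\mu)+F(U)=\sum_{xy}\mu_{xy}U_{xy}\}$ for $U\in\underline{\mathbb R}^{\mathcal X\times\mathcal Y}$. Call $F$ a welfare function if it is convex and lower semicontinuous on $\underline{\mathbb R}^{\mathcal X\times\mathcal Y}$, $\operatorname{dom}F^*$ is compact, $0$ is the least element of $\operatorname{dom}F^*$ for the coordinatewise order, and $F(U)=\max_{\mu\ge 0}\{\sum_{xy}\mu_{xy}U_{xy}-F^*(\mu)\}$ for every $U\in\underline{\mathbb R}^{\mathcal X\times\mathcal Y}$. Call $F$ submodular if $F(U\vee V)+F(U\wedge V)\le F(U)+F(V)$ for all $U,V\in\underline{\mathbb R}^{\mathcal X\times\mathcal Y}$. Then $G$ and $H$ are submodular welfare functions. Moreover, for all $\alpha,\gamma\in\mathbb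 R^{\mathcal X\times\mathcal Y}$ there exists a generalized equilibrium matching between $G$ and $H$ with initial preferences $\alpha,\gamma$, that is, a triple $(\mu,U,V)\in\mathbb R^{\mathcal X\times\mathcal Y}\times\underline{\mathbb R}^{\mathcal X\times\mathcal Y}\times\underline{\mathbb R}^{\mathcal X\times\mathcal Y}$ such that $\max\{U_{xy}-\alpha_{xy},V_{xy}-\gamma_{xy}\}=0$ for all $(x,y)\in\mathcal X\times\mathcal Y$ and $\mu\in\partial G(U)\cap\partial H(V)$. -/

import Mathlib

open MeasureTheory

namespace RandomUtilityMatching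

noncomputable section

/-- `WithBot ℝ` is the set of reals with `-∞` added, in which `0 * ⊥ = 0`, `c * ⊥ = ⊥` for `c > 0`
and `a + ⊥ = ⊥`. It carries its order topology, and `ι → WithBot ℝ` the product topology. -/
instance topologyWithBot : TopologicalSpace (WithBot ℝ) := Preorder.topology (WithBot ℝ)

instance orderTopologyWithBot : OrderTopology (WithBot ℝ) := ⟨rfl⟩

/-- The inclusion of the reals with `-∞` added into the extended reals. -/
def toExtended (a : WithBot ℝ) : EReal := a.recBotCoe ⊥ (fun r : ℝ => (r : EReal))

variable {ι : Type*}

/-- A real vector, seen as a vector with entries in the reals with `-∞` added. -/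
def ofReal (U : ι → ℝ) : ι → WithBot ℝ := fun i => (U i : WithBot ℝ)

/-- Submodularity: `G (U ∨ V) + G (U ∧ V) ≤ G U + G V`. -/
def IsSubmodular (G : (ι → WithBot ℝ) → ℝ) : Prop :=
  ∀ U V : ι → WithBot ℝ, G (U ⊔ V) + G (U ⊓ V) ≤ G U + G V

variable [Fintype ι]

/-- The pairing `∑ i, μ i * U i`, with the convention `0 * (-∞) = 0`. -/
def pairing (μ : ι → ℝ) (U : ι → WithBot ℝ) : WithBot ℝ :=
  ∑ i, (μ i : WithBot ℝ) * U i

/-- The convex conjugate (Legendre transform)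
`G* μ = sup {∑ i, μ i * U i - G U | U ∈ ℝ^ι}`, with values in the extended reals. -/
def conjugate (G : (ι → WithBot ℝ) → ℝ) (μ : ι → ℝ) : EReal :=
  ⨆ U : ι → ℝ, ((∑ i, μ i * U i - G (ofReal U) : ℝ) : EReal)

/-- The effective domain of the conjugate. -/
def conjugateDomain (G : (ι → WithBot ℝ) → ℝ) : Set (ι → ℝ) :=
  {μ | conjugate G μ < ⊤}

/-- The subdifferential `∂G U = {μ | G* μ + G U = ∑ i, μ i * U i}`, at points `U` whose entries may
be `-∞`. -/
def subdifferential (G : (ι → WithBot ℝ) → ℝ) (U : ι → WithBot ℝ) : Set (ι → ℝ) :=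
  {μ | conjugate G μ + (G U : EReal) = toExtended (pairing μ U)}

/-- Welfare functions. `G` is real valued and everywhere defined, hence proper; for such a function
"closed" means lower semicontinuous. The last field says that the values of `G` at vectors with
entries `-∞` are those of the canonical extension of `G` from `ℝ^ι`. -/
structure IsWelfareFunction (G : (ι → WithBot ℝ) → ℝ) : Prop where
  convex : ∀ (U V : ι → WithBot ℝ) (a b : ℝ), 0 < a → 0 < b → a + b = 1 →
    G (fun i => (a : WithBot ℝ) * U i + (b : WithBot ℝ) * V i) ≤ a * G U + b * G V
  lowerSemicontinuous : LowerSemicontinuous G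
  isCompact_conjugateDomain : IsCompact (conjugateDomain G)
  isLeast_zero : IsLeast (conjugateDomain G) 0
  isGreatest : ∀ U : ι → WithBot ℝ,
    IsGreatest ((fun μ : ι → ℝ => toExtended (pairing μ U) - conjugate G μ) '' {μ | 0 ≤ μ})
      (G U : EReal)

/-- `(μ, U, V)` is a generalized equilibrium matching between the welfare functions `G` and `H`,
with initial preferences `α` and `γ`: `max (U - α) (V - γ) = 0` in every coordinate and
`μ ∈ ∂G U ∩ ∂H V`. -/
def IsGeneralizedEquilibrium (G H : (ι → WithBot ℝ) → ℝ) (α γ : ι → ℝ)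
    (μ : ι → ℝ) (U V : ι → WithBot ℝ) : Prop :=
  (∀ i, max (U i + ((-α i : ℝ) : WithBot ℝ)) (V i + ((-γ i : ℝ) : WithBot ℝ)) = 0) ∧
    μ ∈ subdifferential G U ∩ subdifferential H V

variable {A B : Type*} [Fintype B]

/-- The indirect utility `max_b {U b + e b, e 0}` of an agent with systematic utilities `U` and
random utility terms `e`, where `none` stands for the outside option `0`. The maximum is at least
`e none`, hence never `⊥`, and `unbotD` only changes its type. -/
def indirectUtility (U : B → WithBot ℝ) (e : Option B → ℝ) : ℝ :=
  ((e none : WithBot ℝ) ⊔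
    Finset.univ.sup (fun b => U b + ((e (some b) : ℝ) : WithBot ℝ))).unbotD 0

/-- The total indirect utility `∑ a, n a * E_{P a} [max_b {U a b + e b, e 0}]`. -/
def totalIndirectUtility [Fintype A] (n : A → ℝ) (P : A → Measure (Option B → ℝ))
    (U : A → B → WithBot ℝ) : ℝ :=
  ∑ a, n a * ∫ e, indirectUtility (U a) e ∂(P a)

/-- The function `G` of the side `X`: the masses are `n x` and the random utility terms of an agent
of type `x` have law `P x`. -/
def welfareX {X Y : Type*} [Fintype X] [Fintype Y] (n : X → ℝ)
    (P : X → Measure (Option Y → ℝ)) (U : X × Y → WithBot ℝ) : ℝ :=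
  totalIndirectUtility n P (fun x y => U (x, y))

/-- The function `H` of the side `Y`: the masses are `m y` and the random utility terms of an agent
of type `y` have law `Q y`. -/
def welfareY {X Y : Type*} [Fintype X] [Fintype Y] (m : Y → ℝ)
    (Q : Y → Measure (Option X → ℝ)) (V : X × Y → WithBot ℝ) : ℝ :=
  totalIndirectUtility m Q (fun y x => V (x, y))

end

end RandomUtilityMatching

/-! Everything rests on replacing optimal choice by logit choice at a temperature `δ > 0`. Logit
demand is continuous, exhibits gross substitutes (raising the other utilities lowers the demand for
a pair), and is a subgradient of the welfare up to an error of order `δ`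
(`logitDemand_approx_subgradient`). Limits of such approximate subgradients as `δ → 0` are exact,
even when utilities tend to `-∞`, and they vanish at the entries `⊥` (`conjugate_eq_of_tendsto`).

At a fixed vector this gives the maximizer in the dual formula for the welfare, without selecting
among ties; the other welfare properties follow from pointwise estimates on a finite maximum and
from the explicit domain `0 ≤ μ`, `∑ b, μ (a, b) ≤ n a`.

For equilibrium, one real unknown `z i` per pair encodes both utilities, `α i - max (z i) 0` and `γ
i - max (-z i) 0`, so the condition on the maximum holds identically. Gross substitutes solve the
resulting complementarity problem in the box `[-k, k]` (`exists_complementarity`). Let `k → ∞` and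
`δ → 0` along an ultrafilter: where the box binds, one utility becomes `⊥` and its side's demand
vanishes, so the two limit demands agree. -/

open Filter Topology

namespace RandomUtilityMatching

/-! ### Pointwise estimates on the indirect utility. -/

section IndirectUtility

variable {B : Type*} [Fintype B]

lemma coe_indirectUtility (U : B → WithBot ℝ) (e : Option B → ℝ) :
    (indirectUtility U e : WithBot ℝ) = (e none : WithBot ℝ) ⊔
      Finset.univ.sup (fun b => U b + ((e (some b) : ℝ) : WithBot ℝ)) := by
  unfold indirectUtility
  generalize h : (e none : WithBot ℝ) ⊔
      Finset.univ.sup (fun b => U b + ((e (some b) : ℝ) : WithBot ℝ)) = x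
  have hx : (e none : WithBot ℝ) ≤ x := h ▸ le_sup_left
  induction x with
  | bot => simp at hx
  | coe r => rfl

/-- Entries `⊥` impose no condition, so every estimate below reduces to inequalities between reals.
-/
lemma indirectUtility_le_iff {U : B → WithBot ℝ} {e : Option B → ℝ} {r : ℝ} :
    indirectUtility U e ≤ r ↔
      e none ≤ r ∧ ∀ b (u : ℝ), U b = (u : WithBot ℝ) → u + e (some b) ≤ r := by
  rw [← WithBot.coe_le_coe, coe_indirectUtility, sup_le_iff, WithBot.coe_le_coe,
    Finset.sup_le_iff]
  refine and_congr_right fun _ => forall_congr' fun b => ?_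
  induction h : U b with
  | bot => simp
  | coe u =>
    simp only [Finset.mem_univ, true_imp_iff, WithBot.coe_inj, forall_eq']
    exact_mod_cast Iff.rfl

lemma le_indirectUtility_none (U : B → WithBot ℝ) (e : Option B → ℝ) :
    e none ≤ indirectUtility U e := (indirectUtility_le_iff.1 le_rfl).1

lemma le_indirectUtility_some {U : B → WithBot ℝ} (e : Option B → ℝ) {b : B} {u : ℝ}
    (h : U b = (u : WithBot ℝ)) : u + e (some b) ≤ indirectUtility U e :=
  (indirectUtility_le_iff.1 le_rfl).2 b u h

lemma continuous_indirectUtility (U : B → WithBot ℝ) : Continuous (indirectUtility U) := by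
  refine (LipschitzWith.of_le_add fun e e' => ?_ : LipschitzWith 1 _).continuous
  have h : ∀ o, e o ≤ e' o + dist e e' := fun o => by
    have h1 := dist_le_pi_dist e e' o
    have h2 := le_abs_self (e o - e' o)
    rw [Real.dist_eq] at h1
    linarith
  refine indirectUtility_le_iff.2 ⟨?_, fun b u hu => ?_⟩
  · linarith [h none, le_indirectUtility_none U e']
  · linarith [h (some b), le_indirectUtility_some e' hu]

lemma abs_indirectUtility_le {U : B → WithBot ℝ} {c : ℝ} (hc : 0 ≤ c)
    (hU : ∀ b, U b ≤ (c : WithBot ℝ)) (e : Option B → ℝ) :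
    |indirectUtility U e| ≤ ∑ o, |e o| + c := by
  have h : ∀ o, |e o| ≤ ∑ o, |e o| := fun o =>
    Finset.single_le_sum (f := fun o => |e o|) (fun _ _ => abs_nonneg _) (Finset.mem_univ o)
  refine abs_le.2 ⟨?_, indirectUtility_le_iff.2 ⟨?_, fun b u hu => ?_⟩⟩
  · linarith [h none, neg_abs_le (e none), le_indirectUtility_none U e]
  · linarith [h none, le_abs_self (e none)]
  · have := hU b
    rw [hu, WithBot.coe_le_coe] at this
    linarith [h (some b), le_abs_self (e (some b))]

lemma exists_nonneg_upper_bound (U : B → WithBot ℝ) :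
    ∃ c : ℝ, 0 ≤ c ∧ ∀ b, U b ≤ (c : WithBot ℝ) := by
  refine ⟨∑ b, |(U b).unbotD 0|, Finset.sum_nonneg fun _ _ => abs_nonneg _, fun b => ?_⟩
  have h := Finset.single_le_sum (f := fun b => |(U b).unbotD 0|) (fun _ _ => abs_nonneg _)
    (Finset.mem_univ b)
  induction hb : U b with
  | bot => exact bot_le
  | coe u =>
    simp only [hb, WithBot.unbotD_coe] at h
    exact WithBot.coe_le_coe.2 ((le_abs_self u).trans h)

lemma integrable_sum_abs {P : Measure (Option B → ℝ)}
    (hP : ∀ o, Integrable (fun e => e o) P) : Integrable (fun e => ∑ o, |e o|) P :=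
  integrable_finsetSum _ fun o _ => (hP o).abs

lemma integrable_indirectUtility {P : Measure (Option B → ℝ)} [IsProbabilityMeasure P]
    (hP : ∀ o, Integrable (fun e => e o) P) (U : B → WithBot ℝ) :
    Integrable (indirectUtility U) P := by
  obtain ⟨c, hc, hU⟩ := exists_nonneg_upper_bound U
  exact ((integrable_sum_abs hP).add (integrable_const c)).mono'
    (continuous_indirectUtility U).aestronglyMeasurable
    (Eventually.of_forall fun e => abs_indirectUtility_le hc hU e)

/-- The value at `U ⊔ V` is at most the larger of the two values, and by monotonicity the value at
`U ⊓ V` is at most the smaller. -/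
lemma indirectUtility_sup_add_inf_le (U V : B → WithBot ℝ) (e : Option B → ℝ) :
    indirectUtility (U ⊔ V) e + indirectUtility (U ⊓ V) e ≤
      indirectUtility U e + indirectUtility V e := by
  have h1 : indirectUtility (U ⊔ V) e ≤ max (indirectUtility U e) (indirectUtility V e) := by
    refine indirectUtility_le_iff.2 ⟨le_max_of_le_left (le_indirectUtility_none U e),
      fun b u hu => ?_⟩
    rw [Pi.sup_apply] at hu
    rcases le_total (U b) (V b) with h | h
    · rw [sup_eq_right.2 h] at hu
      exact le_max_of_le_right (le_indirectUtility_some e hu)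
    · rw [sup_eq_left.2 h] at hu
      exact le_max_of_le_left (le_indirectUtility_some e hu)
  have h2 : ∀ U V : B → WithBot ℝ, U ≤ V → indirectUtility U e ≤ indirectUtility V e := by
    intro U V h
    refine indirectUtility_le_iff.2 ⟨le_indirectUtility_none V e, fun b u hu => ?_⟩
    obtain ⟨v, hv, huv⟩ := WithBot.coe_le_iff.1 (hu ▸ h b)
    linarith [le_indirectUtility_some e hv]
  have h3 := h2 (U ⊓ V) U inf_le_left
  have h4 := h2 (U ⊓ V) V inf_le_right
  rcases max_choice (indirectUtility U e) (indirectUtility V e) with h | h <;>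
    rw [h] at h1 <;> linarith

lemma indirectUtility_convex (U V : B → WithBot ℝ) {a b : ℝ} (ha : 0 < a) (hb : 0 < b)
    (hab : a + b = 1) (e : Option B → ℝ) :
    indirectUtility (fun i => (a : WithBot ℝ) * U i + (b : WithBot ℝ) * V i) e ≤
      a * indirectUtility U e + b * indirectUtility V e := by
  refine indirectUtility_le_iff.2 ⟨?_, fun i w hw => ?_⟩
  · have h1 := mul_le_mul_of_nonneg_left (le_indirectUtility_none U e) ha.le
    have h2 := mul_le_mul_of_nonneg_left (le_indirectUtility_none V e) hb.le
    have h3 : e none = a * e none + b * e none := by rw [← add_mul, hab, one_mul]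
    linarith
  · have ha' : (a : WithBot ℝ) ≠ 0 := by exact_mod_cast ha.ne'
    have hb' : (b : WithBot ℝ) ≠ 0 := by exact_mod_cast hb.ne'
    induction hu : U i with
    | bot => simp [hu, WithBot.mul_bot ha'] at hw
    | coe u =>
      induction hv : V i with
      | bot => simp [hv, WithBot.mul_bot hb'] at hw
      | coe v =>
        rw [hu, hv] at hw
        have hw' : a * u + b * v = w := by exact_mod_cast hw
        have h1 := mul_le_mul_of_nonneg_left (le_indirectUtility_some e hu) ha.le
        have h2 := mul_le_mul_of_nonneg_left (le_indirectUtility_some e hv) hb.le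
        have h3 : e (some i) = a * e (some i) + b * e (some i) := by rw [← add_mul, hab, one_mul]
        linarith

/-- Monotonicity (`d = 0`) and a one-sided Lipschitz bound in one statement. As `W` is unconstrained
where `U` is `⊥`, it also yields lower semicontinuity. -/
lemma indirectUtility_le_add {U W : B → WithBot ℝ} {d : ℝ} (hd : 0 ≤ d)
    (h : ∀ b (u : ℝ), U b = (u : WithBot ℝ) → ((u - d : ℝ) : WithBot ℝ) ≤ W b)
    (e : Option B → ℝ) : indirectUtility U e ≤ indirectUtility W e + d := by
  refine indirectUtility_le_iff.2 ⟨by linarith [le_indirectUtility_none W e], fun b u hu => ?_⟩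
  obtain ⟨v, hv, huv⟩ := WithBot.coe_le_iff.1 (h b u hu)
  linarith [le_indirectUtility_some e hv]

/-- Replacing the entries `⊥` by `-k`. -/
noncomputable def fillBot {ι : Type*} (U : ι → WithBot ℝ) (k : ℕ) (i : ι) : ℝ :=
  (U i).unbotD (-(k : ℝ))

lemma le_fillBot {ι : Type*} (U : ι → WithBot ℝ) (k : ℕ) : U ≤ ofReal (fillBot U k) := by
  intro i
  unfold ofReal fillBot
  induction U i with
  | bot => exact bot_le
  | coe u => exact le_rfl

lemma tendsto_indirectUtility_fillBot (U : B → WithBot ℝ) (e : Option B → ℝ) :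
    Tendsto (fun k => indirectUtility (ofReal (fillBot U k)) e) atTop
      (𝓝 (indirectUtility U e)) := by
  -- For fixed `e` the sequence is eventually constant: the outside option keeps the maximum finite,
  -- so the filled entries `-k` end up irrelevant.
  refine tendsto_const_nhds.congr' ?_
  have h : ∀ᶠ k : ℕ in atTop, ∀ b, -(k : ℝ) + e (some b) ≤ indirectUtility U e := by
    refine eventually_all.2 fun b => ?_
    filter_upwards [(tendsto_natCast_atTop_atTop (R := ℝ)).eventually_ge_atTop
      (e (some b) - indirectUtility U e)] with k hk
    linarith
  filter_upwards [h] with k hk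
  refine le_antisymm ?_ (indirectUtility_le_iff.2 ⟨le_indirectUtility_none U e, fun b u hu => ?_⟩)
  · have := indirectUtility_le_add (U := U) (W := ofReal (fillBot U k)) le_rfl (d := 0)
      (fun b u hu => by simpa [hu] using le_fillBot U k b) e
    simpa using this
  · have hu' : fillBot U k b = u := WithBot.coe_injective hu
    unfold fillBot at hu'
    induction hb : U b with
    | bot => rw [hb, WithBot.unbotD_bot] at hu'; rw [← hu']; exact hk b
    | coe v =>
      rw [hb, WithBot.unbotD_coe] at hu'
      rw [← hu']; exact le_indirectUtility_some e hb

end IndirectUtility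

/-! ### Logit probabilities. -/

section Softmax

variable {O : Type*} [Fintype O]

/-- The logit choice probabilities with utilities `a` and temperature `δ`. -/
noncomputable def softmax (δ : ℝ) (a : O → ℝ) (o : O) : ℝ :=
  Real.exp (a o / δ) / ∑ o', Real.exp (a o' / δ)

lemma softmax_nonneg (δ : ℝ) (a : O → ℝ) (o : O) : 0 ≤ softmax δ a o := by
  unfold softmax; positivity

lemma sum_exp_pos [Nonempty O] (δ : ℝ) (a : O → ℝ) : 0 < ∑ o, Real.exp (a o / δ) :=
  Finset.sum_pos (fun _ _ => Real.exp_pos _) Finset.univ_nonempty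

lemma sum_softmax [Nonempty O] (δ : ℝ) (a : O → ℝ) : ∑ o, softmax δ a o = 1 := by
  unfold softmax
  rw [← Finset.sum_div, div_self (sum_exp_pos δ a).ne']

lemma softmax_le_one [Nonempty O] (δ : ℝ) (a : O → ℝ) (o : O) : softmax δ a o ≤ 1 := by
  rw [← sum_softmax δ a]
  exact Finset.single_le_sum (fun o _ => softmax_nonneg δ a o) (Finset.mem_univ o)

lemma continuous_softmax [Nonempty O] (δ : ℝ) (o : O) :
    Continuous fun a : O → ℝ => softmax δ a o := by
  unfold softmax
  exact Continuous.div (by fun_prop) (by fun_prop) fun a => (sum_exp_pos δ a).ne'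

/-- Gross substitutes: the numerator is unchanged and the denominator grows. -/
lemma softmax_antitone_of_eq [Nonempty O] {δ : ℝ} (hδ : 0 < δ) {a a' : O → ℝ} (h : a ≤ a') {o : O}
    (ho : a o = a' o) : softmax δ a' o ≤ softmax δ a o := by
  unfold softmax
  rw [ho]
  refine div_le_div_of_nonneg_left (Real.exp_pos _).le (sum_exp_pos δ a)
    (Finset.sum_le_sum fun i _ => Real.exp_le_exp.2 ?_)
  exact div_le_div_of_nonneg_right (h i) hδ.le

/-- An option worse by `s` has probability at most `exp (-s / δ)`, and `t * exp (-t) ≤ 1`; so each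
option contributes a loss of at most `δ`. -/
lemma le_sum_softmax_mul [Nonempty O] {δ : ℝ} (hδ : 0 < δ) (a : O → ℝ) (o : O) :
    a o ≤ ∑ i, softmax δ a i * a i + δ * Fintype.card O := by
  have key : ∀ i, softmax δ a i * (a o - a i) ≤ δ := by
    intro i
    rcases le_total (a o) (a i) with h | h
    · exact (mul_nonpos_of_nonneg_of_nonpos (softmax_nonneg δ a i) (by linarith)).trans hδ.le
    · have h1 : softmax δ a i ≤ Real.exp (a i / δ) / Real.exp (a o / δ) := by
        refine div_le_div_of_nonneg_left (Real.exp_pos _).le (Real.exp_pos _) ?_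
        exact Finset.single_le_sum (f := fun o => Real.exp (a o / δ))
          (fun _ _ => (Real.exp_pos _).le) (Finset.mem_univ o)
      have h2 : (a o - a i) / δ ≤ Real.exp ((a o - a i) / δ) :=
        (by linarith : (a o - a i) / δ ≤ (a o - a i) / δ + 1).trans (Real.add_one_le_exp _)
      calc softmax δ a i * (a o - a i)
          ≤ Real.exp (a i / δ) / Real.exp (a o / δ) * (a o - a i) :=
            mul_le_mul_of_nonneg_right h1 (by linarith)
        _ = δ * ((a o - a i) / δ) / Real.exp ((a o - a i) / δ) := by
            rw [sub_div, Real.exp_sub]; field_simp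
        _ ≤ δ := by
            rw [div_le_iff₀ (Real.exp_pos _)]
            exact mul_le_mul_of_nonneg_left h2 hδ.le
  have h := Finset.sum_le_sum fun i (_ : i ∈ Finset.univ) => key i
  simp only [mul_sub, Finset.sum_sub_distrib, ← Finset.sum_mul, sum_softmax, one_mul,
    Finset.sum_const, Finset.card_univ, nsmul_eq_mul] at h
  linarith

end Softmax

/-- The utilities of the options of an agent, the outside option included. -/
def optionUtility {B : Type*} (u : B → ℝ) (e : Option B → ℝ) : Option B → ℝ
  | none => e none
  | some b => u b + e (some b)

lemma continuous_optionUtility {B : Type*} :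
    Continuous fun p : (B → ℝ) × (Option B → ℝ) => optionUtility p.1 p.2 := by
  refine continuous_pi fun o => ?_
  cases o <;> simp only [optionUtility] <;> fun_prop

/-! ### Logit choice as an approximate subgradient. -/

section LogitChoice

variable {B : Type*} [Fintype B]

lemma optionUtility_le_indirectUtility (u : B → ℝ) (e : Option B → ℝ) (o : Option B) :
    optionUtility u e o ≤ indirectUtility (ofReal u) e := by
  cases o with
  | none => exact le_indirectUtility_none _ e
  | some b => exact le_indirectUtility_some e rfl

/-- Logit choice probabilities are subgradients of the indirect utility up to a multiple of the
temperature. -/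
lemma softmax_approx_subgradient {δ : ℝ} (hδ : 0 < δ) (u w : B → ℝ) (e : Option B → ℝ) :
    ∑ b, softmax δ (optionUtility u e) (some b) * w b - indirectUtility (ofReal w) e +
        indirectUtility (ofReal u) e ≤
      ∑ b, softmax δ (optionUtility u e) (some b) * u b + δ * (Fintype.card B + 1) := by
  have h1 : indirectUtility (ofReal u) e ≤
      ∑ o, softmax δ (optionUtility u e) o * optionUtility u e o + δ * (Fintype.card B + 1) := by
    have h := le_sum_softmax_mul hδ (optionUtility u e)
    simp only [Fintype.card_option, Nat.cast_add, Nat.cast_one] at h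
    refine indirectUtility_le_iff.2 ⟨h none, fun b v hv => ?_⟩
    have hv' : u b = v := WithBot.coe_injective hv
    exact hv' ▸ h (some b)
  have h2 : ∑ o, softmax δ (optionUtility u e) o * optionUtility w e o ≤
      indirectUtility (ofReal w) e := by
    calc _ ≤ ∑ o, softmax δ (optionUtility u e) o * indirectUtility (ofReal w) e :=
          Finset.sum_le_sum fun o _ => mul_le_mul_of_nonneg_left
            (optionUtility_le_indirectUtility w e o) (softmax_nonneg _ _ _)
      _ = _ := by rw [← Finset.sum_mul, sum_softmax, one_mul]
  -- The outside option and the random terms contribute equally for `u` and `w`, hence cancel.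
  simp only [Fintype.sum_option] at h1 h2
  have h3 : ∀ v : B → ℝ, ∑ b, softmax δ (optionUtility u e) (some b) * optionUtility v e (some b) =
      ∑ b, softmax δ (optionUtility u e) (some b) * v b +
        ∑ b, softmax δ (optionUtility u e) (some b) * e (some b) := fun v => by
    simp only [optionUtility, mul_add, Finset.sum_add_distrib]
  rw [h3] at h1 h2
  simp only [optionUtility] at h1 h2 ⊢
  linarith

end LogitChoice

/-! ### Convergence to vectors with entries `-∞`. -/

section TendstoEntries

variable {ι : Type*} {U : ι → WithBot ℝ}

/-- The real vectors `u k` tend to the vector `U` whose entries may be `⊥`. -/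
def TendstoEntries {κ : Type*} (u : κ → ι → ℝ) (F : Filter κ) (U : ι → WithBot ℝ) : Prop :=
  ∀ i, (U i = ⊥ ∧ Tendsto (fun k => u k i) F atBot) ∨
    ∃ r : ℝ, U i = (r : WithBot ℝ) ∧ Tendsto (fun k => u k i) F (𝓝 r)

lemma tendstoEntries_fillBot (U : ι → WithBot ℝ) : TendstoEntries (fillBot U) atTop U := by
  intro i
  unfold fillBot
  induction U i with
  | bot => exact Or.inl ⟨rfl, tendsto_neg_atTop_atBot.comp tendsto_natCast_atTop_atTop⟩
  | coe u => exact Or.inr ⟨u, rfl, tendsto_const_nhds⟩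

lemma TendstoEntries.mono {κ : Type*} {u : κ → ι → ℝ} {F F' : Filter κ}
    (h : TendstoEntries u F U) (hF : F' ≤ F) : TendstoEntries u F' U := fun i =>
  (h i).imp (fun h => ⟨h.1, h.2.mono_left hF⟩) fun ⟨r, h1, h2⟩ => ⟨r, h1, h2.mono_left hF⟩

/-- Along an ultrafilter, vectors that are bounded above have a limit with entries that may be
`⊥`. -/
lemma exists_tendstoEntries {κ : Type*} (F : Ultrafilter κ) {u : κ → ι → ℝ} {c : ι → ℝ}
    (hu : ∀ k i, u k i ≤ c i) : ∃ U : ι → WithBot ℝ, TendstoEntries u F U := by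
  have : ∀ i, ∃ x : WithBot ℝ, (x = ⊥ ∧ Tendsto (fun k => u k i) F atBot) ∨
      ∃ r : ℝ, x = (r : WithBot ℝ) ∧ Tendsto (fun k => u k i) F (𝓝 r) := by
    intro i
    by_cases h : ∃ b, ∀ᶠ k in F, b ≤ u k i
    · obtain ⟨b, hb⟩ := h
      have hmem : Set.Icc b (c i) ∈ F.map (fun k => u k i) := by
        change ∀ᶠ k in F, u k i ∈ Set.Icc b (c i)
        filter_upwards [hb] with k hk using ⟨hk, hu k i⟩
      obtain ⟨r, -, hr⟩ := isCompact_Icc.ultrafilter_le_nhds' _ hmem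
      exact ⟨r, Or.inr ⟨r, rfl, hr⟩⟩
    -- Along an ultrafilter, not being eventually at least `b` means being eventually below `b`.
    · push Not at h
      refine ⟨⊥, Or.inl ⟨rfl, tendsto_atBot.2 fun b => ?_⟩⟩
      filter_upwards [h b] with k hk using hk.le
  choose U hU using this
  exact ⟨U, hU⟩

end TendstoEntries

/-! ### Fenchel duality at vectors with entries `-∞`. -/

section Duality

variable {ι : Type*} [Fintype ι] {G : (ι → WithBot ℝ) → ℝ} {μ : ι → ℝ} {U : ι → WithBot ℝ}

/-- The default value `0` is immaterial, since its coefficient vanishes. -/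
lemma pairing_eq_coe (h : ∀ i, U i = ⊥ → μ i = 0) :
    pairing μ U = ((∑ i, μ i * (U i).unbotD 0 : ℝ) : WithBot ℝ) := by
  have hc : ((∑ i, μ i * (U i).unbotD 0 : ℝ) : WithBot ℝ) =
      ∑ i, ((μ i * (U i).unbotD 0 : ℝ) : WithBot ℝ) :=
    map_sum (⟨⟨WithBot.some, rfl⟩, fun _ _ => rfl⟩ : ℝ →+ WithBot ℝ) _ _
  rw [hc]
  refine Finset.sum_congr rfl fun i _ => ?_
  induction hi : U i with
  | bot => simp [h i hi]
  | coe u => simp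

lemma pairing_eq_bot {i : ι} (hi : U i = ⊥) (hμ : μ i ≠ 0) : pairing μ U = ⊥ := by
  refine WithBot.sum_eq_bot_iff.2 ⟨i, Finset.mem_univ i, ?_⟩
  rw [hi, WithBot.mul_bot (by exact_mod_cast hμ)]

lemma le_conjugate (G : (ι → WithBot ℝ) → ℝ) (μ u : ι → ℝ) :
    ((∑ i, μ i * u i - G (ofReal u) : ℝ) : EReal) ≤ conjugate G μ :=
  le_iSup (fun u : ι → ℝ => ((∑ i, μ i * u i - G (ofReal u) : ℝ) : EReal)) u

/-- The Fenchel inequality, also at vectors with entries `⊥`. -/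
lemma pairing_sub_le_conjugate
    (hG : Tendsto (fun k => G (ofReal (fillBot U k))) atTop (𝓝 (G U)))
    (h : ∀ i, U i = ⊥ → μ i = 0) :
    ((∑ i, μ i * (U i).unbotD 0 - G U : ℝ) : EReal) ≤ conjugate G μ := by
  have hk : ∀ k, ∑ i, μ i * fillBot U k i = ∑ i, μ i * (U i).unbotD 0 := fun k => by
    refine Finset.sum_congr rfl fun i _ => ?_
    unfold fillBot
    induction hi : U i with
    | bot => simp [h i hi]
    | coe u => rfl
  refine le_of_tendsto ((continuous_coe_real_ereal.tendsto _).comp (tendsto_const_nhds.sub hG))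
    (Eventually.of_forall fun k => ?_)
  have := le_conjugate G μ (fillBot U k)
  rwa [hk] at this

lemma conjugate_eq_of_le
    (hG : Tendsto (fun k => G (ofReal (fillBot U k))) atTop (𝓝 (G U)))
    (h : ∀ i, U i = ⊥ → μ i = 0)
    (hle : ∀ w : ι → ℝ, ∑ i, μ i * w i - G (ofReal w) ≤ ∑ i, μ i * (U i).unbotD 0 - G U) :
    conjugate G μ = ((∑ i, μ i * (U i).unbotD 0 - G U : ℝ) : EReal) :=
  le_antisymm (iSup_le fun w => EReal.coe_le_coe_iff.2 (hle w)) (pairing_sub_le_conjugate hG h)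

lemma mem_subdifferential_of_conjugate_eq (h : ∀ i, U i = ⊥ → μ i = 0)
    (hc : conjugate G μ = ((∑ i, μ i * (U i).unbotD 0 - G U : ℝ) : EReal)) :
    μ ∈ subdifferential G U := by
  change conjugate G μ + (G U : EReal) = toExtended (pairing μ U)
  rw [hc, pairing_eq_coe h, ← EReal.coe_add, sub_add_cancel]
  rfl

lemma toExtended_pairing_sub_le
    (hG : Tendsto (fun k => G (ofReal (fillBot U k))) atTop (𝓝 (G U))) :
    toExtended (pairing μ U) - conjugate G μ ≤ (G U : EReal) := by
  by_cases h : ∀ i, U i = ⊥ → μ i = 0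
  · rw [pairing_eq_coe h]
    have h1 := pairing_sub_le_conjugate hG h
    change ((∑ i, μ i * (U i).unbotD 0 : ℝ) : EReal) - conjugate G μ ≤ (G U : EReal)
    induction hc : conjugate G μ with
    | bot => rw [hc] at h1; exact absurd (le_bot_iff.1 h1) (EReal.coe_ne_bot _)
    | top => simp
    | coe c =>
      rw [hc, EReal.coe_le_coe_iff] at h1
      rw [← EReal.coe_sub, EReal.coe_le_coe_iff]
      linarith
  · push Not at h
    obtain ⟨i, hi, hμ⟩ := h
    rw [pairing_eq_bot hi hμ]
    change (⊥ : EReal) - conjugate G μ ≤ (G U : EReal)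
    simp

/-- Limits of approximate subgradients are subgradients, also at vectors with entries `⊥`. -/
lemma conjugate_eq_of_tendsto {κ : Type*} {F : Filter κ} [F.NeBot] {N : ℝ} (hN : 0 ≤ N)
    (hG : Tendsto (fun k => G (ofReal (fillBot U k))) atTop (𝓝 (G U)))
    (hshift : ∀ W d, 0 ≤ d →
      (∀ i (r : ℝ), U i = (r : WithBot ℝ) → ((r - d : ℝ) : WithBot ℝ) ≤ W i) →
      G U ≤ G W + N * d)
    {u ν : κ → ι → ℝ} {δ : κ → ℝ} (hν : ∀ k i, 0 ≤ ν k i) (hδ : Tendsto δ F (𝓝 0))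
    (happrox : ∀ k w, ∑ i, ν k i * w i - G (ofReal w) + G (ofReal (u k)) ≤
      ∑ i, ν k i * u k i + δ k)
    (hνμ : Tendsto ν F (𝓝 μ)) (hu : TendstoEntries u F U) :
    (∀ i, U i = ⊥ → μ i = 0) ∧
      conjugate G μ = ((∑ i, μ i * (U i).unbotD 0 - G U : ℝ) : EReal) := by
  have hνi : ∀ i, Tendsto (fun k => ν k i) F (𝓝 (μ i)) := fun i => (tendsto_pi_nhds.1 hνμ) i
  have hlow : ∀ η > 0, ∀ᶠ k in F, G U ≤ G (ofReal (u k)) + N * η := by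
    intro η hη
    have : ∀ᶠ k in F, ∀ i (r : ℝ), U i = (r : WithBot ℝ) →
        ((r - η : ℝ) : WithBot ℝ) ≤ ofReal (u k) i := by
      refine eventually_all.2 fun i => ?_
      rcases hu i with ⟨hi, -⟩ | ⟨r, hi, hr⟩
      · exact Eventually.of_forall fun k r h => by simp [hi] at h
      · filter_upwards [hr.eventually (lt_mem_nhds (sub_lt_self r hη))] with k hk r' hr'
        rw [hi, WithBot.coe_inj] at hr'
        exact WithBot.coe_le_coe.2 (hr' ▸ hk.le)
    filter_upwards [this] with k hk using hshift _ η hη.le hk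
  -- Testing `happrox` at `w = 0` bounds `∑ ν * u` from below. If `μ i > 0`, the term at `i` tends
  -- to `-∞` while the others stay bounded above.
  have hzero : ∀ i, U i = ⊥ → μ i = 0 := by
    intro i hi
    have hbot : Tendsto (fun k => u k i) F atBot := by
      rcases hu i with ⟨-, h⟩ | ⟨r, hr, -⟩
      · exact h
      · simp [hi] at hr
    by_contra hne
    have hpos : 0 < μ i :=
      lt_of_le_of_ne (ge_of_tendsto (hνi i) (Eventually.of_forall fun k => hν k i)) (Ne.symm hne)
    have hprod : Tendsto (fun k => ν k i * u k i) F atBot := (hνi i).pos_mul_atBot hpos hbot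
    have hothers : ∀ᶠ k in F, ∀ j, ν k j * u k j ≤ |μ j * (U j).unbotD 0| + 1 := by
      refine eventually_all.2 fun j => ?_
      rcases hu j with ⟨-, hj⟩ | ⟨r, hr, hj⟩
      · filter_upwards [hj.eventually_le_atBot 0] with k hk
        have := mul_nonpos_of_nonneg_of_nonpos (hν k j) hk
        have := abs_nonneg (μ j * (U j).unbotD 0)
        linarith
      · rw [hr, WithBot.unbotD_coe]
        refine ((hνi j).mul hj).eventually (ge_mem_nhds ?_)
        linarith [le_abs_self (μ j * r)]
    have hδ1 : ∀ᶠ k in F, δ k ≤ 1 := hδ.eventually (ge_mem_nhds one_pos)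
    obtain ⟨k, h1, h2, h3, h4⟩ := (hothers.and (hδ1.and ((hlow 1 one_pos).and
      (hprod.eventually_lt_atBot (G U - N - G (ofReal 0) - 1 -
        ∑ j, (|μ j * (U j).unbotD 0| + 1)))))).exists
    have h5 := happrox k 0
    simp only [Pi.zero_apply, mul_zero, Finset.sum_const_zero] at h5
    have h6 : ∑ j, ν k j * u k j ≤ ν k i * u k i + ∑ j, (|μ j * (U j).unbotD 0| + 1) := by
      classical
      rw [← Finset.add_sum_erase _ _ (Finset.mem_univ i)]
      refine add_le_add le_rfl ((Finset.sum_le_sum fun j _ => h1 j).trans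
        (Finset.sum_le_sum_of_subset_of_nonneg (Finset.erase_subset _ _) fun j _ _ => ?_))
      positivity
    linarith
  refine ⟨hzero, conjugate_eq_of_le hG hzero fun w => ?_⟩
  -- At an entry `⊥` the product has the indeterminate form `0 * (-∞)`; only its sign is known, and
  -- an upper bound is all that is needed.
  have hup : ∀ i, ∀ η > 0, ∀ᶠ k in F, ν k i * u k i ≤ μ i * (U i).unbotD 0 + η := by
    intro i η hη
    rcases hu i with ⟨hi, hb⟩ | ⟨r, hi, hr⟩
    · filter_upwards [hb.eventually_le_atBot 0] with k hk
      rw [hzero i hi, zero_mul, zero_add]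
      exact (mul_nonpos_of_nonneg_of_nonpos (hν k i) hk).trans hη.le
    · rw [hi, WithBot.unbotD_coe]
      exact ((hνi i).mul hr).eventually (ge_mem_nhds (lt_add_of_pos_right _ hη))
  -- The errors are `N * η` from `hlow`, one `η` per index from `hup`, and one each from the pairing
  -- with `w` and from `δ`.
  have key : ∀ η > 0, ∑ i, μ i * w i - G (ofReal w) ≤
      ∑ i, μ i * (U i).unbotD 0 - G U + (N + Fintype.card ι + 2) * η := by
    intro η hη
    have h1 : ∀ᶠ k in F, ∑ i, μ i * w i - η ≤ ∑ i, ν k i * w i :=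
      (tendsto_finsetSum _ fun i _ => (hνi i).mul_const (w i)).eventually
        (le_mem_nhds (sub_lt_self _ hη))
    obtain ⟨k, h1, h2, h3, h4⟩ := (h1.and ((hlow η hη).and
      ((eventually_all.2 fun i => hup i η hη).and (hδ.eventually (ge_mem_nhds hη))))).exists
    have h5 := Finset.sum_le_sum fun i (_ : i ∈ Finset.univ) => h3 i
    rw [Finset.sum_add_distrib, Finset.sum_const, Finset.card_univ, nsmul_eq_mul] at h5
    linarith [happrox k w]
  have hC : 0 < N + Fintype.card ι + 2 := by positivity
  refine le_of_forall_pos_le_add fun η hη => ?_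
  have := key (η / (N + Fintype.card ι + 2)) (div_pos hη hC)
  rwa [mul_div_cancel₀ _ hC.ne'] at this

end Duality

/-! ### Expected logit demand. -/

section LogitDemand

variable {A B ι : Type*} [Fintype B]

/-- The expected demand for the logit choice probabilities at temperature `δ`. -/
noncomputable def logitDemand (σ : A × B ≃ ι) (n : A → ℝ) (P : A → Measure (Option B → ℝ))
    (δ : ℝ) (u : ι → ℝ) (i : ι) : ℝ :=
  n (σ.symm i).1 * ∫ e, softmax δ (optionUtility (fun b => u (σ ((σ.symm i).1, b))) e)
    (some (σ.symm i).2) ∂(P (σ.symm i).1)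

variable {σ : A × B ≃ ι} {n : A → ℝ} {P : A → Measure (Option B → ℝ)}

lemma logitDemand_apply (δ : ℝ) (u : ι → ℝ) (a : A) (b : B) :
    logitDemand σ n P δ u (σ (a, b)) =
      n a * ∫ e, softmax δ (optionUtility (fun b => u (σ (a, b))) e) (some b) ∂(P a) := by
  unfold logitDemand
  rw [Equiv.symm_apply_apply]

lemma integrable_softmax [∀ a, IsProbabilityMeasure (P a)] (a : A) (δ : ℝ) (u : B → ℝ)
    (o : Option B) : Integrable (fun e => softmax δ (optionUtility u e) o) (P a) := by
  refine (integrable_const (1 : ℝ)).mono' (Continuous.aestronglyMeasurable ?_)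
    (Eventually.of_forall fun e => ?_)
  · exact (continuous_softmax δ o).comp
      (continuous_optionUtility.comp (continuous_const.prodMk continuous_id))
  · rw [Real.norm_of_nonneg (softmax_nonneg _ _ _)]
    exact softmax_le_one _ _ _

lemma logitDemand_nonneg (hn : ∀ a, 0 ≤ n a) (δ : ℝ) (u : ι → ℝ) : 0 ≤ logitDemand σ n P δ u :=
  fun _ => mul_nonneg (hn _) (integral_nonneg fun _ => softmax_nonneg _ _ _)

lemma logitDemand_le (hn : ∀ a, 0 ≤ n a) [∀ a, IsProbabilityMeasure (P a)] (δ : ℝ) (u : ι → ℝ)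
    (i : ι) : logitDemand σ n P δ u i ≤ n (σ.symm i).1 := by
  refine mul_le_of_le_one_right (hn _) ?_
  have := integral_mono (integrable_softmax (P := P) (σ.symm i).1 δ
    (fun b => u (σ ((σ.symm i).1, b))) (some (σ.symm i).2)) (integrable_const (1 : ℝ))
    fun e => softmax_le_one _ _ _
  simpa using this

lemma continuous_logitDemand [Finite ι] [∀ a, IsProbabilityMeasure (P a)] (δ : ℝ) :
    Continuous (logitDemand σ n P δ) := by
  refine continuous_pi fun i => continuous_const.mul ?_
  refine continuous_of_dominated (bound := fun _ => 1)
    (fun u => (integrable_softmax _ _ _ _).aestronglyMeasurable)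
    (fun u => Eventually.of_forall fun e => ?_) (integrable_const _)
    (Eventually.of_forall fun e => ?_)
  · rw [Real.norm_of_nonneg (softmax_nonneg _ _ _)]
    exact softmax_le_one _ _ _
  · exact (continuous_softmax δ _).comp (continuous_optionUtility.comp
      (.prodMk (by fun_prop) continuous_const))

lemma logitDemand_antitone_of_eq (hn : ∀ a, 0 ≤ n a) [∀ a, IsProbabilityMeasure (P a)] {δ : ℝ}
    (hδ : 0 < δ) {u u' : ι → ℝ} (h : u ≤ u') {i : ι} (hi : u i = u' i) :
    logitDemand σ n P δ u' i ≤ logitDemand σ n P δ u i := by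
  refine mul_le_mul_of_nonneg_left (integral_mono (integrable_softmax _ _ _ _)
    (integrable_softmax _ _ _ _) fun e => softmax_antitone_of_eq hδ (fun o => ?_) ?_) (hn _)
  · cases o with
    | none => exact le_rfl
    | some b => exact add_le_add (h _) le_rfl
  · simp [optionUtility, hi]

lemma exists_tendsto_logitDemand (hn : ∀ a, 0 ≤ n a) [∀ a, IsProbabilityMeasure (P a)]
    {κ : Type*} (F : Ultrafilter κ) (u : κ → ι → ℝ) (δ : κ → ℝ) :
    ∃ μ, 0 ≤ μ ∧ Tendsto (fun k => logitDemand σ n P (δ k) (u k)) F (𝓝 μ) := by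
  have hmem : Set.Icc (0 : ι → ℝ) (fun i => n (σ.symm i).1) ∈
      F.map fun k => logitDemand σ n P (δ k) (u k) :=
    Eventually.of_forall (f := (F : Filter κ)) fun k =>
      ⟨logitDemand_nonneg hn _ _, fun i => logitDemand_le hn _ _ i⟩
  obtain ⟨μ, h, hμ⟩ := isCompact_Icc.ultrafilter_le_nhds' _ hmem
  exact ⟨μ, h.1, hμ⟩

end LogitDemand

/-! ### The welfare function and its conjugate. -/

section Welfare

variable {A B ι : Type*} [Fintype A] [Fintype B]

/-- The total indirect utility as a function of vectors indexed by a type identified with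
`A × B`. -/
noncomputable def welfare (σ : A × B ≃ ι) (n : A → ℝ) (P : A → Measure (Option B → ℝ))
    (U : ι → WithBot ℝ) : ℝ :=
  totalIndirectUtility n P (fun a b => U (σ (a, b)))

variable {σ : A × B ≃ ι} {n : A → ℝ} {P : A → Measure (Option B → ℝ)}

lemma sum_eq_sum_sum [Fintype ι] (σ : A × B ≃ ι) (f : ι → ℝ) :
    ∑ i, f i = ∑ a, ∑ b, f (σ (a, b)) := by
  rw [← σ.sum_comp, Fintype.sum_prod_type]

lemma isSubmodular_welfare (hn : ∀ a, 0 ≤ n a) [∀ a, IsProbabilityMeasure (P a)]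
    (hP : ∀ a, ∀ o, Integrable (fun e => e o) (P a)) : IsSubmodular (welfare σ n P) := by
  intro U V
  simp only [welfare, totalIndirectUtility]
  rw [← Finset.sum_add_distrib, ← Finset.sum_add_distrib]
  refine Finset.sum_le_sum fun a _ => ?_
  rw [← mul_add, ← mul_add, ← integral_add (integrable_indirectUtility (hP a) _)
    (integrable_indirectUtility (hP a) _), ← integral_add (integrable_indirectUtility (hP a) _)
    (integrable_indirectUtility (hP a) _)]
  refine mul_le_mul_of_nonneg_left (integral_mono
    ((integrable_indirectUtility (hP a) _).add (integrable_indirectUtility (hP a) _))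
    ((integrable_indirectUtility (hP a) _).add (integrable_indirectUtility (hP a) _))
    fun e => ?_) (hn a)
  exact indirectUtility_sup_add_inf_le (fun b => U (σ (a, b))) (fun b => V (σ (a, b))) e

lemma welfare_convex (hn : ∀ a, 0 ≤ n a) [∀ a, IsProbabilityMeasure (P a)]
    (hP : ∀ a, ∀ o, Integrable (fun e => e o) (P a)) (U V : ι → WithBot ℝ) {s t : ℝ}
    (hs : 0 < s) (ht : 0 < t) (hst : s + t = 1) :
    welfare σ n P (fun i => (s : WithBot ℝ) * U i + (t : WithBot ℝ) * V i) ≤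
      s * welfare σ n P U + t * welfare σ n P V := by
  simp only [welfare, totalIndirectUtility]
  rw [Finset.mul_sum, Finset.mul_sum, ← Finset.sum_add_distrib]
  refine Finset.sum_le_sum fun a _ => ?_
  rw [mul_left_comm s, mul_left_comm t, ← mul_add, ← integral_const_mul s, ← integral_const_mul t,
    ← integral_add ((integrable_indirectUtility (hP a) _).const_mul s)
      ((integrable_indirectUtility (hP a) _).const_mul t)]
  refine mul_le_mul_of_nonneg_left (integral_mono (integrable_indirectUtility (hP a) _)
    (((integrable_indirectUtility (hP a) _).const_mul s).add
      ((integrable_indirectUtility (hP a) _).const_mul t)) fun e => ?_) (hn a)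
  exact indirectUtility_convex (fun b => U (σ (a, b))) (fun b => V (σ (a, b))) hs ht hst e

lemma welfare_le_add (hn : ∀ a, 0 ≤ n a) [∀ a, IsProbabilityMeasure (P a)]
    (hP : ∀ a, ∀ o, Integrable (fun e => e o) (P a)) {U W : ι → WithBot ℝ} {d : ℝ} (hd : 0 ≤ d)
    (h : ∀ i (r : ℝ), U i = (r : WithBot ℝ) → ((r - d : ℝ) : WithBot ℝ) ≤ W i) :
    welfare σ n P U ≤ welfare σ n P W + (∑ a, n a) * d := by
  simp only [welfare, totalIndirectUtility]
  rw [Finset.sum_mul, ← Finset.sum_add_distrib]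
  refine Finset.sum_le_sum fun a _ => ?_
  rw [← mul_add]
  refine mul_le_mul_of_nonneg_left ?_ (hn a)
  have : ∫ e, (indirectUtility (fun b => W (σ (a, b))) e + d) ∂(P a) =
      ∫ e, indirectUtility (fun b => W (σ (a, b))) e ∂(P a) + d := by
    rw [integral_add (integrable_indirectUtility (hP a) _) (integrable_const d)]
    simp
  rw [← this]
  exact integral_mono (integrable_indirectUtility (hP a) _)
    ((integrable_indirectUtility (hP a) _).add (integrable_const d)) fun e =>
      indirectUtility_le_add hd (fun b r hr => h _ r hr) e

lemma lowerSemicontinuous_welfare [Finite ι] (hn : ∀ a, 0 ≤ n a)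
    [∀ a, IsProbabilityMeasure (P a)] (hP : ∀ a, ∀ o, Integrable (fun e => e o) (P a)) :
    LowerSemicontinuous (welfare σ n P) := by
  intro U y hy
  have hN : 0 < ∑ a, n a + 1 := by linarith [Finset.sum_nonneg fun a (_ : a ∈ Finset.univ) => hn a]
  -- Shifting by `d` costs at most `(∑ a, n a) * d`; the `+ 1` keeps this strictly below the gap.
  set d := (welfare σ n P U - y) / (∑ a, n a + 1) with hd
  have hdpos : 0 < d := div_pos (sub_pos.2 hy) hN
  have hdN : (∑ a, n a) * d + d = welfare σ n P U - y := by rw [hd]; field_simp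
  have : ∀ᶠ W in 𝓝 U, ∀ i (r : ℝ), U i = (r : WithBot ℝ) →
      ((r - d : ℝ) : WithBot ℝ) ≤ W i := by
    refine eventually_all.2 fun i => ?_
    induction hi : U i with
    | bot => exact Eventually.of_forall fun W r hr => by simp at hr
    | coe u =>
      have hlt : ((u - d : ℝ) : WithBot ℝ) < U i := by
        rw [hi]; exact WithBot.coe_lt_coe.2 (sub_lt_self u hdpos)
      filter_upwards [((continuous_apply i).tendsto U).eventually (lt_mem_nhds hlt)] with W hW r hr
      rw [WithBot.coe_inj] at hr
      exact hr ▸ hW.le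
  filter_upwards [this] with W hW
  have := welfare_le_add (σ := σ) hn hP hdpos.le hW
  linarith

lemma tendsto_welfare_fillBot [∀ a, IsProbabilityMeasure (P a)]
    (hP : ∀ a, ∀ o, Integrable (fun e => e o) (P a)) (U : ι → WithBot ℝ) :
    Tendsto (fun k => welfare σ n P (ofReal (fillBot U k))) atTop (𝓝 (welfare σ n P U)) := by
  refine tendsto_finsetSum _ fun a _ => Tendsto.const_mul _ ?_
  obtain ⟨c, hc, hU⟩ := exists_nonneg_upper_bound (fun b => U (σ (a, b)))
  refine tendsto_integral_of_dominated_convergence (fun e => ∑ o, |e o| + c)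
    (fun k => (continuous_indirectUtility _).aestronglyMeasurable)
    ((integrable_sum_abs (hP a)).add (integrable_const c))
    (fun k => Eventually.of_forall fun e => abs_indirectUtility_le hc (fun b => ?_) e)
    (Eventually.of_forall fun e => tendsto_indirectUtility_fillBot (fun b => U (σ (a, b))) e)
  have := hU b
  change ((fillBot U k (σ (a, b)) : ℝ) : WithBot ℝ) ≤ c
  unfold fillBot
  induction hb : U (σ (a, b)) with
  | bot =>
    rw [WithBot.unbotD_bot, WithBot.coe_le_coe]
    linarith [(Nat.cast_nonneg k : (0 : ℝ) ≤ k)]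
  | coe u => simpa [hb] using this

lemma logitDemand_approx_subgradient [Fintype ι] (hn : ∀ a, 0 ≤ n a)
    [∀ a, IsProbabilityMeasure (P a)] (hP : ∀ a, ∀ o, Integrable (fun e => e o) (P a)) {δ : ℝ}
    (hδ : 0 < δ) (u w : ι → ℝ) :
    ∑ i, logitDemand σ n P δ u i * w i - welfare σ n P (ofReal w) + welfare σ n P (ofReal u) ≤
      ∑ i, logitDemand σ n P δ u i * u i + (∑ a, n a) * (Fintype.card B + 1) * δ := by
  have hsum : ∀ v : ι → ℝ, ∑ i, logitDemand σ n P δ u i * v i = ∑ a, n a *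
      ∫ e, ∑ b, softmax δ (optionUtility (fun b => u (σ (a, b))) e) (some b) * v (σ (a, b))
        ∂(P a) := fun v => by
    rw [sum_eq_sum_sum σ]
    refine Finset.sum_congr rfl fun a _ => ?_
    rw [integral_finsetSum _ fun b _ => (integrable_softmax a δ _ _).mul_const _, Finset.mul_sum]
    refine Finset.sum_congr rfl fun b _ => ?_
    rw [logitDemand_apply, integral_mul_const, mul_assoc]
  rw [hsum, hsum]
  simp only [welfare, totalIndirectUtility]
  rw [Finset.sum_mul, Finset.sum_mul, ← Finset.sum_sub_distrib, ← Finset.sum_add_distrib,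
    ← Finset.sum_add_distrib]
  refine Finset.sum_le_sum fun a _ => ?_
  rw [← mul_sub, ← mul_add, mul_assoc, ← mul_add]
  refine mul_le_mul_of_nonneg_left ?_ (hn a)
  have hint : ∀ v : B → ℝ, Integrable (fun e => ∑ b, softmax δ (optionUtility
      (fun b => u (σ (a, b))) e) (some b) * v b) (P a) := fun v =>
    integrable_finsetSum _ fun b _ => (integrable_softmax a δ _ _).mul_const _
  have hI := fun v : ι → ℝ => integrable_indirectUtility (hP a) fun b => ofReal v (σ (a, b))
  have hsub : Integrable (fun e => ∑ b, softmax δ (optionUtility (fun b => u (σ (a, b))) e)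
      (some b) * w (σ (a, b)) - indirectUtility (fun b => ofReal w (σ (a, b))) e) (P a) :=
    (hint _).sub (hI w)
  rw [← integral_sub (hint _) (hI w), ← integral_add hsub (hI u)]
  have hc : ((Fintype.card B + 1) * δ : ℝ) = ∫ _, δ * (Fintype.card B + 1) ∂(P a) := by
    simp [mul_comm]
  rw [hc, ← integral_add (hint _) (integrable_const _)]
  exact integral_mono (hsub.add (hI u)) ((hint _).add (integrable_const _))
    fun e => softmax_approx_subgradient hδ _ (fun b => w (σ (a, b))) e

/-- Limits of logit demands, with temperatures tending to `0`, are subgradients. -/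
lemma conjugate_eq_of_tendsto_logitDemand [Fintype ι] (hn : ∀ a, 0 ≤ n a)
    [∀ a, IsProbabilityMeasure (P a)] (hP : ∀ a, ∀ o, Integrable (fun e => e o) (P a))
    {κ : Type*} {F : Filter κ} [F.NeBot] {u : κ → ι → ℝ} {δ : κ → ℝ} (hδ : ∀ k, 0 < δ k)
    (hδ0 : Tendsto δ F (𝓝 0)) {μ : ι → ℝ} {U : ι → WithBot ℝ}
    (hμ : Tendsto (fun k => logitDemand σ n P (δ k) (u k)) F (𝓝 μ)) (hu : TendstoEntries u F U) :
    (∀ i, U i = ⊥ → μ i = 0) ∧ conjugate (welfare σ n P) μ =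
      ((∑ i, μ i * (U i).unbotD 0 - welfare σ n P U : ℝ) : EReal) := by
  refine conjugate_eq_of_tendsto (Finset.sum_nonneg fun a _ => hn a)
    (tendsto_welfare_fillBot hP U) (fun W d hd h => welfare_le_add hn hP hd h)
    (δ := fun k => (∑ a, n a) * (Fintype.card B + 1) * δ k)
    (fun k => logitDemand_nonneg hn _ _) ?_
    (fun k w => logitDemand_approx_subgradient hn hP (hδ k) _ w) hμ hu
  simpa using hδ0.const_mul ((∑ a, n a) * (Fintype.card B + 1))

lemma exists_conjugate_eq [Fintype ι] (hn : ∀ a, 0 ≤ n a) [∀ a, IsProbabilityMeasure (P a)]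
    (hP : ∀ a, ∀ o, Integrable (fun e => e o) (P a)) (U : ι → WithBot ℝ) :
    ∃ μ : ι → ℝ, 0 ≤ μ ∧ (∀ i, U i = ⊥ → μ i = 0) ∧ conjugate (welfare σ n P) μ =
      ((∑ i, μ i * (U i).unbotD 0 - welfare σ n P U : ℝ) : EReal) := by
  obtain ⟨μ, h0, hμ⟩ := exists_tendsto_logitDemand (σ := σ) (P := P) hn (hyperfilter ℕ)
    (fillBot U) (fun k => 1 / ((k : ℝ) + 1))
  exact ⟨μ, h0, conjugate_eq_of_tendsto_logitDemand hn hP (fun k => by positivity)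
    (tendsto_one_div_add_atTop_nhds_zero_nat.mono_left Nat.hyperfilter_le_atTop) hμ
    ((tendstoEntries_fillBot U).mono Nat.hyperfilter_le_atTop)⟩

lemma conjugateDomain_welfare [Fintype ι] (hn : ∀ a, 0 ≤ n a)
    [∀ a, IsProbabilityMeasure (P a)] (hP : ∀ a, ∀ o, Integrable (fun e => e o) (P a)) :
    conjugateDomain (welfare σ n P) = {μ | 0 ≤ μ ∧ ∀ a, ∑ b, μ (σ (a, b)) ≤ n a} := by
  classical
  have hbdd : ∀ μ, conjugate (welfare σ n P) μ < ⊤ → ∃ c : ℝ, ∀ u : ι → ℝ,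
      ∑ i, μ i * u i - welfare σ n P (ofReal u) ≤ c := by
    intro μ hμ
    induction hc : conjugate (welfare σ n P) μ with
    | bot => exact ⟨0, fun u => absurd (le_bot_iff.1 (hc ▸ le_conjugate _ μ u))
        (EReal.coe_ne_bot _)⟩
    | top => rw [hc] at hμ; exact absurd rfl hμ.ne
    | coe c => exact ⟨c, fun u => EReal.coe_le_coe_iff.1 (hc ▸ le_conjugate _ μ u)⟩
  ext μ
  constructor
  · intro hμ
    obtain ⟨c, hc⟩ := hbdd μ hμ
    constructor
    · intro i
      by_contra hi
      rw [Pi.zero_apply, not_le] at hi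
      -- Lowering entry `i` to `-t` does not raise the welfare but adds `-μ i * t` to the pairing,
      -- enough to exceed the bound `c`.
      set t := (|c + welfare σ n P (ofReal 0)| + 1) / -μ i with ht
      have ht0 : 0 ≤ t := div_nonneg (by positivity) (by linarith)
      have h1 := hc (Pi.single i (-t))
      have h2 : ∑ j, μ j * (Pi.single i (-t) : ι → ℝ) j = |c + welfare σ n P (ofReal 0)| + 1 := by
        simp only [Pi.single_apply, mul_ite, mul_zero, Finset.sum_ite_eq', Finset.mem_univ, if_true]
        rw [ht]; field_simp [hi.ne]
      have h3 : welfare σ n P (ofReal (Pi.single i (-t))) ≤ welfare σ n P (ofReal 0) := by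
        have := welfare_le_add (σ := σ) hn hP (U := ofReal (Pi.single i (-t)))
          (W := ofReal (0 : ι → ℝ)) le_rfl fun j r hr => by
            have hr' : (Pi.single i (-t) : ι → ℝ) j = r := WithBot.coe_injective hr
            refine WithBot.coe_le_coe.2 ?_
            rw [← hr', Pi.single_apply, Pi.zero_apply]
            split_ifs <;> linarith
        simpa using this
      linarith [le_abs_self (c + welfare σ n P (ofReal 0))]
    · intro a
      by_contra ha
      rw [not_le] at ha
      set t := (|c + welfare σ n P (ofReal 0)| + 1) / (∑ b, μ (σ (a, b)) - n a) with ht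
      have ht0 : 0 ≤ t := div_nonneg (by positivity) (by linarith)
      have ht1 : t * (∑ b, μ (σ (a, b)) - n a) = |c + welfare σ n P (ofReal 0)| + 1 :=
        div_mul_cancel₀ _ (by linarith)
      -- Raising all inside options of `a` by `t` costs at most `n a * t` and gains `t * ∑ b, μ (σ
      -- (a, b))`.
      set u : ι → ℝ := fun i => if (σ.symm i).1 = a then t else 0 with hu
      have h1 := hc u
      have h2 : ∑ j, μ j * u j = t * ∑ b, μ (σ (a, b)) := by
        rw [sum_eq_sum_sum σ, Finset.sum_eq_single a]
        · simp [hu, ← Finset.sum_mul, mul_comm]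
        · intro a' _ h; simp [hu, h]
        · simp
      have h3 : welfare σ n P (ofReal u) ≤ welfare σ n P (ofReal 0) + n a * t := by
        simp only [welfare, totalIndirectUtility]
        rw [← Finset.add_sum_erase _ _ (Finset.mem_univ a),
          ← Finset.add_sum_erase Finset.univ (fun a => n a * ∫ e, indirectUtility
            (fun b => ofReal (0 : ι → ℝ) (σ (a, b))) e ∂(P a)) (Finset.mem_univ a)]
        have h4 : ∫ e, indirectUtility (fun b => ofReal u (σ (a, b))) e ∂(P a) ≤
            ∫ e, indirectUtility (fun b => ofReal (0 : ι → ℝ) (σ (a, b))) e ∂(P a) + t := by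
          have : ∫ e, (indirectUtility (fun b => ofReal (0 : ι → ℝ) (σ (a, b))) e + t) ∂(P a) =
              ∫ e, indirectUtility (fun b => ofReal (0 : ι → ℝ) (σ (a, b))) e ∂(P a) + t := by
            rw [integral_add (integrable_indirectUtility (hP a) _) (integrable_const t)]
            simp
          rw [← this]
          refine integral_mono (integrable_indirectUtility (hP a) _)
            ((integrable_indirectUtility (hP a) _).add (integrable_const t)) fun e =>
              indirectUtility_le_add ht0 (fun b r hr => ?_) e
          have hr' : u (σ (a, b)) = r := WithBot.coe_injective hr
          refine WithBot.coe_le_coe.2 ?_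
          rw [← hr']; simp [hu]
        have h5 : ∑ a' ∈ Finset.univ.erase a,
            n a' * ∫ e, indirectUtility (fun b => ofReal u (σ (a', b))) e ∂(P a') =
            ∑ a' ∈ Finset.univ.erase a, n a' * ∫ e, indirectUtility
              (fun b => ofReal (0 : ι → ℝ) (σ (a', b))) e ∂(P a') := by
          refine Finset.sum_congr rfl fun a' ha' => ?_
          have : (fun b => ofReal u (σ (a', b))) = fun b => ofReal (0 : ι → ℝ) (σ (a', b)) := by
            funext b
            simp [ofReal, hu, Finset.ne_of_mem_erase ha']
          rw [this]
        linarith [mul_le_mul_of_nonneg_left h4 (hn a)]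
      linarith [le_abs_self (c + welfare σ n P (ofReal 0))]
  · rintro ⟨h0, hμ⟩
    -- Each `u b` is at most the indirect utility plus `∑ o, |e o|`, a nonnegative quantity;
    -- weighting by `μ`, of total mass at most `n a`, bounds the conjugate independently of `u`.
    refine lt_of_le_of_lt (iSup_le fun u => EReal.coe_le_coe_iff.2 ?_)
      (EReal.coe_lt_top (∑ a, n a * ∫ e, ∑ o, |e o| ∂(P a)))
    rw [sum_eq_sum_sum σ, sub_le_iff_le_add]
    simp only [welfare, totalIndirectUtility]
    rw [← Finset.sum_add_distrib]
    refine Finset.sum_le_sum fun a _ => ?_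
    rw [← mul_add, ← integral_add (integrable_sum_abs (hP a)) (integrable_indirectUtility (hP a) _),
      ← integral_const_mul]
    have : ∑ b, μ (σ (a, b)) * u (σ (a, b)) = ∫ _, ∑ b, μ (σ (a, b)) * u (σ (a, b)) ∂(P a) := by
      simp
    rw [this]
    refine integral_mono (integrable_const _) (((integrable_sum_abs (hP a)).add
      (integrable_indirectUtility (hP a) _)).const_mul _) fun e => ?_
    have h : ∀ o, |e o| ≤ ∑ o, |e o| := fun o =>
      Finset.single_le_sum (f := fun o => |e o|) (fun _ _ => abs_nonneg _) (Finset.mem_univ o)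
    set I := indirectUtility (fun b => ofReal u (σ (a, b))) e with hI
    have hI0 : 0 ≤ ∑ o, |e o| + I := by
      linarith [h none, neg_abs_le (e none),
        le_indirectUtility_none (fun b => ofReal u (σ (a, b))) e]
    calc ∑ b, μ (σ (a, b)) * u (σ (a, b)) ≤ ∑ b, μ (σ (a, b)) * (∑ o, |e o| + I) := by
          refine Finset.sum_le_sum fun b _ => mul_le_mul_of_nonneg_left ?_ (h0 _)
          have := le_indirectUtility_some (U := fun b => ofReal u (σ (a, b))) e (b := b) rfl
          linarith [h (some b), neg_abs_le (e (some b))]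
      _ ≤ n a * (∑ o, |e o| + I) := by
          rw [← Finset.sum_mul]
          exact mul_le_mul_of_nonneg_right (hμ a) hI0

theorem isWelfareFunction_welfare [Fintype ι] (hn : ∀ a, 0 ≤ n a)
    [∀ a, IsProbabilityMeasure (P a)] (hP : ∀ a, ∀ o, Integrable (fun e => e o) (P a)) :
    IsWelfareFunction (welfare σ n P) where
  convex U V s t hs ht hst := welfare_convex hn hP U V hs ht hst
  lowerSemicontinuous := lowerSemicontinuous_welfare hn hP
  isCompact_conjugateDomain := by
    rw [conjugateDomain_welfare hn hP]
    refine isCompact_Icc.of_isClosed_subset (s := Set.Icc (0 : ι → ℝ) fun i => n (σ.symm i).1)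
      ?_ fun μ hμ => ⟨hμ.1, fun i => ?_⟩
    · simp only [Set.ofPred_and, Set.ofPred_forall]
      exact isClosed_Ici.inter (isClosed_iInter fun a => isClosed_le (by fun_prop) (by fun_prop))
    · have := hμ.2 (σ.symm i).1
      refine le_trans ?_ this
      have h := Finset.single_le_sum (f := fun b => μ (σ ((σ.symm i).1, b)))
        (fun b _ => hμ.1 _) (Finset.mem_univ (σ.symm i).2)
      simpa using h
  isLeast_zero := by
    rw [conjugateDomain_welfare hn hP]
    exact ⟨⟨le_rfl, fun a => by simpa using hn a⟩, fun μ hμ => hμ.1⟩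
  isGreatest U := by
    constructor
    · obtain ⟨μ, h0, hbot, hc⟩ := exists_conjugate_eq (σ := σ) hn hP U
      refine ⟨μ, h0, ?_⟩
      change toExtended (pairing μ U) - conjugate (welfare σ n P) μ = _
      rw [hc, pairing_eq_coe hbot]
      change ((_ : ℝ) : EReal) - _ = _
      rw [← EReal.coe_sub, sub_sub_cancel]
    · rintro _ ⟨μ, -, rfl⟩
      exact toExtended_pairing_sub_le (tendsto_welfare_fillBot hP U)

end Welfare

/-! ### Existence of equilibrium. -/

section Equilibrium

/-- A continuous map whose components are antitone in the other coordinates has a solution of the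
complementarity problem in every box. -/
lemma exists_complementarity {ι : Type*} [Fintype ι] {Q : (ι → ℝ) → ι → ℝ} (hQ : Continuous Q)
    (hanti : ∀ z z' i, z ≤ z' → z i = z' i → Q z' i ≤ Q z i) {l h : ℝ} (hlh : l ≤ h) :
    ∃ z : ι → ℝ, ∀ i, (Q z i ≤ 0 ∨ z i = l) ∧ (0 ≤ Q z i ∨ z i = h) := by
  classical
  -- Subsolutions in the box, the lowest corner among them. At one of maximal coordinate sum, if `Q
  -- z i < 0` and `z i < h`, raising `z i` slightly keeps `Q i` negative and does not raise the
  -- other components: a larger subsolution.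
  set S : Set (ι → ℝ) := Set.Icc (fun _ => l) (fun _ => h) ∩
    ⋂ i, ({z | Q z i ≤ 0} ∪ {z | z i = l}) with hS
  have hSc : IsCompact S := isCompact_Icc.inter_right <| isClosed_iInter fun i =>
    (isClosed_le ((continuous_apply i).comp hQ) continuous_const).union
      (isClosed_eq (continuous_apply i) continuous_const)
  obtain ⟨z, hz, hmax⟩ := hSc.exists_isMaxOn (f := fun z : ι → ℝ => ∑ i, z i)
    ⟨fun _ => l, ⟨le_rfl, fun _ => hlh⟩, Set.mem_iInter.2 fun i => Or.inr rfl⟩ (by fun_prop)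
  have hzi := Set.mem_iInter.1 hz.2
  refine ⟨z, fun i => ⟨hzi i, ?_⟩⟩
  by_contra! hcon
  have hlt : z i < h := lt_of_le_of_ne (hz.1.2 i) hcon.2
  have hcont : Continuous fun t => Q (Function.update z i t) i :=
    (continuous_apply i).comp (hQ.comp (continuous_const.update i continuous_id))
  have hneg : ∀ᶠ t in 𝓝[>] (z i), Q (Function.update z i t) i < 0 :=
    nhdsWithin_le_nhds ((hcont.tendsto (z i)).eventually (gt_mem_nhds (by
      rw [Function.update_eq_self]; exact hcon.1)))
  have hlt' : ∀ᶠ t in 𝓝[>] (z i), t < h := nhdsWithin_le_nhds (gt_mem_nhds hlt)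
  obtain ⟨t, h1, h2, h3 : z i < t⟩ := (hneg.and (hlt'.and self_mem_nhdsWithin)).exists
  have hle : z ≤ Function.update z i t := le_update_self_iff.2 h3.le
  have hmem : Function.update z i t ∈ S := by
    refine ⟨⟨fun j => (hz.1.1 j).trans (hle j), fun j => ?_⟩, Set.mem_iInter.2 fun j => ?_⟩
    · by_cases hj : j = i
      · subst hj; simpa using h2.le
      · simpa [hj] using hz.1.2 j
    · by_cases hj : j = i
      · subst hj; exact Or.inl h1.le
      · have hj' : z j = Function.update z i t j := by simp [hj]
        rcases hzi j with h | h
        · exact Or.inl ((hanti _ _ j hle hj').trans h)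
        · exact Or.inr (hj'.symm.trans h)
  have hsum : ∑ j, z j < ∑ j, Function.update z i t j :=
    Finset.sum_lt_sum (fun j _ => hle j) ⟨i, Finset.mem_univ i, by simpa using h3⟩
  exact (hmax hmem).not_gt hsum

lemma TendstoEntries.eq_bot {ι κ : Type*} {F : Filter κ} [F.NeBot] {u : κ → ι → ℝ}
    {U : ι → WithBot ℝ} (h : TendstoEntries u F U) {i : ι}
    (hi : Tendsto (fun k => u k i) F atBot) : U i = ⊥ := by
  rcases h i with h | ⟨r, -, hr⟩
  · exact h.1
  · exact absurd hr (not_tendsto_nhds_of_tendsto_atBot hi r)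

lemma TendstoEntries.eq_coe {ι κ : Type*} {F : Filter κ} [F.NeBot] {u : κ → ι → ℝ}
    {U : ι → WithBot ℝ} (h : TendstoEntries u F U) {i : ι} {r : ℝ}
    (hi : Tendsto (fun k => u k i) F (𝓝 r)) : U i = (r : WithBot ℝ) := by
  rcases h i with h | ⟨s, hs, hr⟩
  · exact absurd hi (not_tendsto_nhds_of_tendsto_atBot h.2 r)
  · rw [hs, tendsto_nhds_unique hr hi]

lemma TendstoEntries.le_coe {ι κ : Type*} {F : Filter κ} [F.NeBot] {u : κ → ι → ℝ}
    {U : ι → WithBot ℝ} (h : TendstoEntries u F U) {i : ι} {c : ℝ} (hc : ∀ k, u k i ≤ c) :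
    U i ≤ (c : WithBot ℝ) := by
  rcases h i with h | ⟨s, hs, hr⟩
  · rw [h.1]; exact bot_le
  · rw [hs]
    exact WithBot.coe_le_coe.2 (le_of_tendsto hr (Eventually.of_forall hc))

lemma add_coe_neg_le_zero {x : WithBot ℝ} {c : ℝ} (h : x ≤ (c : WithBot ℝ)) :
    x + ((-c : ℝ) : WithBot ℝ) ≤ 0 := by
  induction x with
  | bot => simp
  | coe r =>
    rw [WithBot.coe_le_coe] at h
    rw [← WithBot.coe_add, ← WithBot.coe_zero, WithBot.coe_le_coe]
    linarith

lemma coe_add_coe_neg (c : ℝ) : (c : WithBot ℝ) + ((-c : ℝ) : WithBot ℝ) = 0 := by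
  rw [← WithBot.coe_add, add_neg_cancel, WithBot.coe_zero]

theorem exists_isGeneralizedEquilibrium {A B C D ι : Type*} [Fintype A] [Fintype B] [Fintype C]
    [Fintype D] [Fintype ι] (σ : A × B ≃ ι) (τ : C × D ≃ ι) {n : A → ℝ} {m : C → ℝ}
    (hn : ∀ a, 0 ≤ n a) (hm : ∀ c, 0 ≤ m c) {P : A → Measure (Option B → ℝ)}
    {R : C → Measure (Option D → ℝ)} [∀ a, IsProbabilityMeasure (P a)]
    [∀ c, IsProbabilityMeasure (R c)] (hP : ∀ a, ∀ o, Integrable (fun e => e o) (P a))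
    (hR : ∀ c, ∀ o, Integrable (fun e => e o) (R c)) (α γ : ι → ℝ) :
    ∃ (μ : ι → ℝ) (U V : ι → WithBot ℝ),
      IsGeneralizedEquilibrium (welfare σ n P) (welfare τ m R) α γ μ U V := by
  set u : (ι → ℝ) → ι → ℝ := fun z i => α i - max (z i) 0 with hu
  set v : (ι → ℝ) → ι → ℝ := fun z i => γ i - max (-z i) 0 with hv
  set δ : ℕ → ℝ := fun k => 1 / ((k : ℝ) + 1) with hδ
  have hδpos : ∀ k, 0 < δ k := fun k => by simp only [hδ]; positivity
  have hcu : Continuous u := by simp only [hu]; fun_prop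
  have hcv : Continuous v := by simp only [hv]; fun_prop
  have hex : ∀ k : ℕ, ∃ z : ι → ℝ, ∀ i,
      (logitDemand τ m R (δ k) (v z) i ≤ logitDemand σ n P (δ k) (u z) i ∨ z i = -k) ∧
      (logitDemand σ n P (δ k) (u z) i ≤ logitDemand τ m R (δ k) (v z) i ∨ z i = k) := by
    intro k
    obtain ⟨z, hz⟩ := exists_complementarity
      (Q := fun z i => logitDemand τ m R (δ k) (v z) i - logitDemand σ n P (δ k) (u z) i)
      (continuous_pi fun i =>
        ((continuous_apply i).comp ((continuous_logitDemand (δ k)).comp hcv)).sub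
        ((continuous_apply i).comp ((continuous_logitDemand (δ k)).comp hcu)))
      (fun z z' i hzz hi => sub_le_sub
        (logitDemand_antitone_of_eq hm (hδpos k)
          (fun j => sub_le_sub_left (max_le_max_right 0 (neg_le_neg (hzz j))) (γ j))
          (by simp only [hi]))
        (logitDemand_antitone_of_eq hn (hδpos k)
          (fun j => sub_le_sub_left (max_le_max_right 0 (hzz j)) (α j))
          (by simp only [hi])))
      (l := -k) (h := k) (by linarith [(Nat.cast_nonneg k : (0 : ℝ) ≤ k)])
    exact ⟨z, fun i => ⟨(hz i).1.imp_left sub_nonpos.1, (hz i).2.imp_left sub_nonneg.1⟩⟩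
  choose z hz using hex
  set F := hyperfilter ℕ
  have hF : (F : Filter ℕ) ≤ atTop := Nat.hyperfilter_le_atTop
  have huα : ∀ k i, u (z k) i ≤ α i := fun k i => sub_le_self _ (le_max_right _ _)
  have hvγ : ∀ k i, v (z k) i ≤ γ i := fun k i => sub_le_self _ (le_max_right _ _)
  obtain ⟨U, hU⟩ := exists_tendstoEntries F huα
  obtain ⟨V, hV⟩ := exists_tendstoEntries F hvγ
  obtain ⟨μ, hμ0, hμ⟩ := exists_tendsto_logitDemand (σ := σ) (P := P) hn F (fun k => u (z k)) δ
  obtain ⟨ν, hν0, hν⟩ := exists_tendsto_logitDemand (σ := τ) (P := R) hm F (fun k => v (z k)) δ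
  have hδ0 : Tendsto δ F (𝓝 0) := tendsto_one_div_add_atTop_nhds_zero_nat.mono_left hF
  obtain ⟨hUbot, hUc⟩ := conjugate_eq_of_tendsto_logitDemand hn hP hδpos hδ0 hμ hU
  obtain ⟨hVbot, hVc⟩ := conjugate_eq_of_tendsto_logitDemand hm hR hδpos hδ0 hν hV
  have hbot : ∀ c : ℝ, Tendsto (fun k : ℕ => c - max (k : ℝ) 0) F atBot := fun c => by
    refine Tendsto.mono_left ?_ hF
    simp only [Nat.cast_nonneg, max_eq_left]
    exact tendsto_atBot_add_const_left _ c
      (tendsto_neg_atTop_atBot.comp tendsto_natCast_atTop_atTop)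
  -- One of the two alternatives in `hz` holds on a set of the ultrafilter: either the demands
  -- compare directly, or `z k i = ∓k` and the demand to be bounded above vanishes in the limit.
  have hμν : ν = μ := by
    funext i
    refine le_antisymm ?_ ?_
    · rcases Ultrafilter.eventually_or.1 (Eventually.of_forall fun k => (hz k i).1) with h | h
      · exact le_of_tendsto_of_tendsto (tendsto_pi_nhds.1 hν i) (tendsto_pi_nhds.1 hμ i) h
      · rw [hVbot i (hV.eq_bot ((hbot (γ i)).congr' ?_))]
        · exact hμ0 i
        · filter_upwards [h] with k hk
          simp only [hv, hk, neg_neg]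
    · rcases Ultrafilter.eventually_or.1 (Eventually.of_forall fun k => (hz k i).2) with h | h
      · exact le_of_tendsto_of_tendsto (tendsto_pi_nhds.1 hμ i) (tendsto_pi_nhds.1 hν i) h
      · rw [hUbot i (hU.eq_bot ((hbot (α i)).congr' ?_))]
        · exact hν0 i
        · filter_upwards [h] with k hk
          simp only [hu, hk]
  subst hμν
  refine ⟨ν, U, V, fun i => ?_, mem_subdifferential_of_conjugate_eq hUbot hUc,
    mem_subdifferential_of_conjugate_eq hVbot hVc⟩
  -- The ultrafilter fixes a sign for `z k i`; the side not penalized by that sign keeps exactly its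
  -- initial utility.
  rcases Ultrafilter.eventually_or.1 (Eventually.of_forall (f := (F : Filter ℕ))
    fun k => le_total (z k i) 0) with h | h
  · have hUi : U i = (α i : WithBot ℝ) := hU.eq_coe (tendsto_const_nhds.congr' (by
      filter_upwards [h] with k hk
      simp only [hu, max_eq_right hk, sub_zero]))
    rw [hUi, coe_add_coe_neg, max_eq_left (add_coe_neg_le_zero (hV.le_coe fun k => hvγ k i))]
  · have hVi : V i = (γ i : WithBot ℝ) := hV.eq_coe (tendsto_const_nhds.congr' (by
      filter_upwards [h] with k hk
      simp only [hv, max_eq_right (neg_nonpos.2 hk), sub_zero]))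
    rw [hVi, coe_add_coe_neg, max_eq_right (add_coe_neg_le_zero (hU.le_coe fun k => huα k i))]

end Equilibrium

end RandomUtilityMatching

theorem mainTheorem5 {X Y : Type*} [Fintype X] [Fintype Y]
    (n : X → ℝ) (m : Y → ℝ) (hn : ∀ x, 0 < n x) (hm : ∀ y, 0 < m y)
    (P : X → Measure (Option Y → ℝ)) (Q : Y → Measure (Option X → ℝ))
    [∀ x, IsProbabilityMeasure (P x)] [∀ y, IsProbabilityMeasure (Q y)]
    (hP : ∀ x, ∀ o : Option Y, Integrable (fun e => e o) (P x))
    (hQ : ∀ y, ∀ o : Option X, Integrable (fun e => e o) (Q y)) :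
    (RandomUtilityMatching.IsWelfareFunction (RandomUtilityMatching.welfareX n P) ∧
      RandomUtilityMatching.IsSubmodular (RandomUtilityMatching.welfareX n P)) ∧
    (RandomUtilityMatching.IsWelfareFunction (RandomUtilityMatching.welfareY m Q) ∧
      RandomUtilityMatching.IsSubmodular (RandomUtilityMatching.welfareY m Q)) ∧
    ∀ α γ : X × Y → ℝ, ∃ (μ : X × Y → ℝ) (U V : X × Y → WithBot ℝ),
      RandomUtilityMatching.IsGeneralizedEquilibrium
        (RandomUtilityMatching.welfareX n P) (RandomUtilityMatching.welfareY m Q) α γ μ U V := by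
  -- The two sides differ only in how `X × Y` is read as pairs of an agent type and an option.
  have hX : RandomUtilityMatching.welfareX n P =
      RandomUtilityMatching.welfare (Equiv.refl (X × Y)) n P := rfl
  have hY : RandomUtilityMatching.welfareY m Q =
      RandomUtilityMatching.welfare (Equiv.prodComm Y X) m Q := rfl
  rw [hX, hY]
  have hn' := fun x => (hn x).le
  have hm' := fun y => (hm y).le
  exact ⟨⟨RandomUtilityMatching.isWelfareFunction_welfare hn' hP,
      RandomUtilityMatching.isSubmodular_welfare hn' hP⟩,
    ⟨RandomUtilityMatching.isWelfareFunction_welfare hm' hQ,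
      RandomUtilityMatching.isSubmodular_welfare hm' hQ⟩,
    RandomUtilityMatching.exists_isGeneralizedEquilibrium _ _ hn' hm' hP hQ⟩
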